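/- Let $p$ be a prime and let $R$ be a commutative Noetherian reduced ring of characteristic $p$ that is $F$-finite (the Frobenius map $R\to R$ is finite). Let $R^\circ$ be the set of elements of $R$ lying in no minimal prime, let $\mathfrak a\subseteq R$ be an ideal with $\mathfrak a\cap R^\circ\neq\emptyset$, and let $t>0$ be a real number. The pair $(R,\mathfrak a^t)$ is called locally sharply $F$-pure if for some integer $e>0$ there is a surjective $R$-linear map $\varphi\in \operatorname{Hom}_R(R^{1/p^e},R)\cdot\bigl(\mathfrak a^{\lceil t(p^e-1)\rceil}\bigr)^{1/p^e}$, that is, a surjective map of the form $\varphi(y)=\sum_{i=1}^m\varphi_i\bigl(a_i^{1/p^e}y\bigr)$ with $\varphi_i\in\operatorname{Hom}_R(R^{1/p^e},R)$ and $a_i\in\mathfrak a^{\lceil t(p^e-1)\rceil}$. For an $R$-module $M$ let $F^e(M)=R^{1/p^e}\otimes_R M$, regarded as an $R$-module through the ring isomorphism $R\cong R^{1/p^e}$, $x\mapsto x^{1/p^e}$, and for $z\in M$ let $z^{p^e}=1\otimes z\in F^e(M)$. The $\mathfrak a^t$-tight closure $0^{*\mathfrak a^t}_M$ of zero in $M$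 is the set of $z\in M$ for which there is $c\in R^\circ$ with $c\,\mathfrak a^{\lceil tp^e\rceil}z^{p^e}=0$ in $F^e(M)$ for all $e\gg0$. The Hara–Yoshida generalized test ideal is $$\tau(R,\mathfrak a^t)=\bigcap_M \operatorname{Ann}_R\bigl(0^{*\mathfrak a^t}_M\bigr),$$ where $M$ runs over all finitely generated $R$-modules. If $(R,\mathfrak a^t)$ is locally sharply $F$-pure, then $\tau(R,\mathfrak a^t)$ is a radical ideal. -/

import Mathlib

universe u

/-- `R°`: the elements of `R` that lie in no minimal prime of `R`. -/
def ringCirc (R : Type u) [CommRing R] : Set R :=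
  {c | ∀ P ∈ minimalPrimes R, c ∉ P}

/-- The ring `R^{1/p^e}` of `p^e`-th roots of elements of the reduced ring `R`. Its elements are
the symbols `x^{1/p^e}` with `x` in `R`, and `x ↦ x^{1/p^e}` is a ring isomorphism, so the
underlying ring is a copy of `R`. -/
def FrobRoot (R : Type u) (_p _e : ℕ) : Type u := R

instance (R : Type u) [CommRing R] (p e : ℕ) : CommRing (FrobRoot R p e) :=
  inferInstanceAs (CommRing R)

/-- The isomorphism `R ≃ R^{1/p^e}`, `x ↦ x^{1/p^e}`. -/
def FrobRoot.root (R : Type u) [CommRing R] (p e : ℕ) : R ≃+* FrobRoot R p e :=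
  RingEquiv.refl R

/-- The inclusion `R ⊆ R^{1/p^e}`, `r ↦ (r^{p^e})^{1/p^e}`, which makes `R^{1/p^e}` an
`R`-algebra. -/
instance (R : Type u) [CommRing R] (p e : ℕ) [Fact p.Prime] [CharP R p] :
    Algebra R (FrobRoot R p e) :=
  ((FrobRoot.root R p e).toRingHom.comp (iterateFrobenius R p e)).toAlgebra

theorem FrobRoot.smul_root (R : Type u) [CommRing R] (p e : ℕ) [Fact p.Prime] [CharP R p]
    (r x : R) : r • FrobRoot.root R p e x = FrobRoot.root R p e (r ^ p ^ e * x) := by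
  rw [Algebra.smul_def, map_mul]
  rfl

/-- `Hom_R(R^{1/p^e}, R) · J^{1/p^e}`, i.e. all finite sums of maps `y ↦ ψ (a^{1/p^e} y)` with
`ψ : R^{1/p^e} → R` an `R`-linear map and `a ∈ J`. Since `J` is an ideal, this `R`-span is already
stable under the action of `R^{1/p^e}` by premultiplication
(see `homMulRoot_comp_mem`). -/
def homMulRoot (R : Type u) [CommRing R] (p e : ℕ) [Fact p.Prime] [CharP R p] (J : Ideal R) :
    Submodule R (FrobRoot R p e →ₗ[R] R) :=
  Submodule.span R
    {φ | ∃ ψ : FrobRoot R p e →ₗ[R] R, ∃ a ∈ J,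
      φ = ψ ∘ₗ LinearMap.mulLeft R (FrobRoot.root R p e a)}

theorem homMulRoot_comp_mem (R : Type u) [CommRing R] (p e : ℕ) [Fact p.Prime] [CharP R p]
    (J : Ideal R) (φ : FrobRoot R p e →ₗ[R] R) (hφ : φ ∈ homMulRoot R p e J)
    (s : FrobRoot R p e) : φ ∘ₗ LinearMap.mulLeft R s ∈ homMulRoot R p e J := by
  induction hφ using Submodule.span_induction with
  | mem φ h =>
    obtain ⟨ψ, a, ha, rfl⟩ := h
    refine Submodule.subset_span ⟨ψ ∘ₗ LinearMap.mulLeft R s, a, ha, ?_⟩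
    ext y
    simp [mul_left_comm]
  | zero => simp
  | add x y _ _ hx hy => rw [LinearMap.add_comp]; exact add_mem hx hy
  | smul r x _ hx => rw [LinearMap.smul_comp]; exact Submodule.smul_mem _ r hx

/-- The pair `(R, 𝔞^t)` is locally sharply `F`-pure: for some `e > 0` there is a surjective map in
`Hom_R(R^{1/p^e}, R) · (𝔞^{⌈t(p^e - 1)⌉})^{1/p^e}`. -/
def IsLocallySharplyFPure (R : Type u) [CommRing R] (p : ℕ) [Fact p.Prime] [CharP R p]
    (𝔞 : Ideal R) (t : ℝ) : Prop :=
  ∃ e : ℕ, 0 < e ∧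
    ∃ φ ∈ homMulRoot R p e (𝔞 ^ ⌈t * ((p : ℝ) ^ e - 1)⌉₊), Function.Surjective φ

open scoped TensorProduct in
/-- The `𝔞^t`-tight closure `0^{*𝔞^t}_M` of zero in an `R`-module `M`: the elements `z` for which
there is `c ∈ R°` with `c 𝔞^{⌈t p^e⌉} z^{p^e} = 0` in `F^e(M)` for all `e ≫ 0`. Here
`F^e(M) = R^{1/p^e} ⊗_R M` is the base change of `M` along the `e`-th iterate of Frobenius, and
`z^{p^e}` is `1 ⊗ z`. -/
def zeroTightClosure (R : Type u) [CommRing R] (p : ℕ) [Fact p.Prime] [CharP R p]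
    (𝔞 : Ideal R) (t : ℝ) (M : Type u) [AddCommGroup M] [Module R M] : Set M :=
  {z | ∃ c ∈ ringCirc R, ∃ e₀ : ℕ, ∀ e ≥ e₀, ∀ a ∈ 𝔞 ^ ⌈t * (p : ℝ) ^ e⌉₊,
    FrobRoot.root R p e (c * a) • ((1 : FrobRoot R p e) ⊗ₜ[R] z) =
      (0 : FrobRoot R p e ⊗[R] M)}

/-- The Hara–Yoshida generalized test ideal `τ(R, 𝔞^t)`: the intersection of the annihilators of
`0^{*𝔞^t}_M` over all finitely generated `R`-modules `M`. -/
def testIdeal (R : Type u) [CommRing R] (p : ℕ) [Fact p.Prime] [CharP R p]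
    (𝔞 : Ideal R) (t : ℝ) : Ideal R where
  carrier := {r | ∀ (M : Type u) [AddCommGroup M] [Module R M] [Module.Finite R M],
    ∀ z ∈ zeroTightClosure R p 𝔞 t M, r • z = 0}
  zero_mem' := fun _ _ _ _ _ _ => zero_smul _ _
  add_mem' := fun hr hs M _ _ _ z hz => by rw [add_smul, hr M z hz, hs M z hz, add_zero]
  smul_mem' := fun s r hr M _ _ _ z hz => by rw [smul_eq_mul, mul_smul, hr M z hz, smul_zero]

/-! It suffices to extract `p ^ e`-th roots in `τ`, with `e` from sharp `F`-purity, and iterate. Let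
`r ^ p ^ e ∈ τ` and `z ∈ 0^{*𝔞^t}_M`. For `a ∈ 𝔞^{⌈t(p^e - 1)⌉}`, the element `a z^{p^e}` lies in
the tight closure of zero in `F^e(M)` (`smul_tmul_mem_zeroTightClosure`), so `a (rz)^{p^e} = r^{p^e}
a z^{p^e} = 0`. Hence every value of the surjection `φ` kills `rz`
(`apply_smul_eq_zero_of_mem_homMulRoot`), and the value `1` gives `rz = 0`. -/

open scoped TensorProduct in
/-- `F^e(M) = R^{1/p^e} ⊗_R M`, regarded as an `R`-module through `R ≃ R^{1/p^e}`. -/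
def FrobModule (R : Type u) [CommRing R] (p e : ℕ) [Fact p.Prime] [CharP R p]
    (M : Type u) [AddCommGroup M] [Module R M] : Type u :=
  FrobRoot R p e ⊗[R] M

namespace FrobModule

variable (R : Type u) [CommRing R] (p e : ℕ) [Fact p.Prime] [CharP R p]
  (M : Type u) [AddCommGroup M] [Module R M]

instance : AddCommGroup (FrobModule R p e M) :=
  inferInstanceAs (AddCommGroup (TensorProduct R (FrobRoot R p e) M))

instance : Module (FrobRoot R p e) (FrobModule R p e M) :=
  inferInstanceAs (Module (FrobRoot R p e) (TensorProduct R (FrobRoot R p e) M))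

instance : Module R (FrobModule R p e M) :=
  Module.compHom (FrobModule R p e M) (FrobRoot.root R p e).toRingHom

/-- The element `s ⊗ m` of `F^e(M)`. -/
def tmul (s : FrobRoot R p e) (m : M) : FrobModule R p e M :=
  s ⊗ₜ[R] m

variable {R p e M}

theorem smul_def (r : R) (x : FrobModule R p e M) : r • x = FrobRoot.root R p e r • x :=
  rfl

theorem smul_tmul (r : R) (s : FrobRoot R p e) (m : M) :
    r • tmul R p e M s m = tmul R p e M (FrobRoot.root R p e r * s) m :=
  rfl

theorem one_tmul_smul (r : R) (m : M) :
    tmul R p e M 1 (r • m) = r ^ p ^ e • tmul R p e M 1 m := by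
  have h : (1 : FrobRoot R p e) ⊗ₜ[R] (r • m) = (r • (1 : FrobRoot R p e)) ⊗ₜ[R] m :=
    (TensorProduct.smul_tmul r 1 m).symm
  rw [smul_tmul]
  refine h.trans ?_
  have h1 : r • (1 : FrobRoot R p e) = FrobRoot.root R p e (r ^ p ^ e) * 1 := by
    have := FrobRoot.smul_root R p e r 1
    rwa [map_one, mul_one, ← mul_one (FrobRoot.root R p e _)] at this
  rw [h1]
  rfl

/-- Needed because `testIdeal` only tests finitely generated modules, and it gets applied to
`F^e(M)`. -/
instance [Module.Finite R M] : Module.Finite R (FrobModule R p e M) := by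
  have : Module.Finite (FrobRoot R p e) (FrobModule R p e M) :=
    inferInstanceAs (Module.Finite (FrobRoot R p e) (TensorProduct R (FrobRoot R p e) M))
  obtain ⟨S, hS⟩ := this.fg_top
  refine ⟨⟨S, eq_top_iff.2 fun x _ => ?_⟩⟩
  have hx : x ∈ Submodule.span (FrobRoot R p e) (S : Set (FrobModule R p e M)) := hS ▸ trivial
  induction hx using Submodule.span_induction with
  | mem x h => exact Submodule.subset_span h
  | zero => exact zero_mem _
  | add x y _ _ hx hy => exact add_mem (hx trivial) (hy trivial)
  | smul s x _ hx =>
    obtain ⟨r, rfl⟩ := (FrobRoot.root R p e).surjective s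
    rw [← smul_def]
    exact Submodule.smul_mem _ r (hx trivial)

variable (R p e M) in
open scoped TensorProduct in
/-- The comparison map `F^{e+e'}(M) → F^{e'}(F^e(M))`. -/
def comparison (e' : ℕ) :
    FrobRoot R p (e + e') ⊗[R] M →+ FrobRoot R p e' ⊗[R] FrobModule R p e M :=
  TensorProduct.liftAddHom
    (AddMonoidHom.mk' (fun s => AddMonoidHom.mk'
      (fun m => FrobRoot.root R p e' ((FrobRoot.root R p (e + e')).symm s) ⊗ₜ[R]
        tmul R p e M 1 m)
      fun m n => by
        rw [← TensorProduct.tmul_add]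
        exact congrArg _ (TensorProduct.tmul_add 1 m n))
      fun s s' => by
        ext m
        simp [TensorProduct.add_tmul])
    -- Balancedness: on both sides `r` ends up acting as `r ^ p ^ (e + e')` on the root of `s`.
    fun r s m => by
      obtain ⟨s, rfl⟩ := (FrobRoot.root R p (e + e')).surjective s
      simp only [AddMonoidHom.mk'_apply]
      rw [one_tmul_smul, ← TensorProduct.smul_tmul, FrobRoot.smul_root, FrobRoot.smul_root,
        RingEquiv.symm_apply_apply, RingEquiv.symm_apply_apply, ← pow_mul, ← pow_add]

open scoped TensorProduct in
theorem comparison_root_tmul (e' : ℕ) (s : R) (m : M) :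
    comparison R p e M e' (FrobRoot.root R p (e + e') s ⊗ₜ[R] m) =
      FrobRoot.root R p e' s ⊗ₜ[R] tmul R p e M 1 m :=
  rfl

end FrobModule

/-- The exponents add up since `t(p^e - 1)p^{e'} + tp^{e'} = tp^{e+e'}`; this is where the `- 1` in
sharp purity is used. -/
theorem pow_mul_mem_pow_ceil {R : Type u} [CommRing R] (𝔞 : Ideal R) (t : ℝ) (p e e' : ℕ) {a b : R}
    (ha : a ∈ 𝔞 ^ ⌈t * ((p : ℝ) ^ e - 1)⌉₊) (hb : b ∈ 𝔞 ^ ⌈t * (p : ℝ) ^ e'⌉₊) :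
    a ^ p ^ e' * b ∈ 𝔞 ^ ⌈t * (p : ℝ) ^ (e + e')⌉₊ := by
  have h := Ideal.mul_mem_mul (Ideal.pow_mem_pow ha (p ^ e')) hb
  rw [← pow_mul, ← pow_add] at h
  refine Ideal.pow_le_pow_right (Nat.ceil_le.2 ?_) h
  push_cast
  have h1 := mul_le_mul_of_nonneg_right (Nat.le_ceil (t * ((p : ℝ) ^ e - 1)))
    (by positivity : (0 : ℝ) ≤ (p : ℝ) ^ e')
  have h2 := Nat.le_ceil (t * (p : ℝ) ^ e')
  rw [pow_add]
  linarith

/-- If `z` lies in the `𝔞^t`-tight closure of zero in `M` and `a ∈ 𝔞^{⌈t(p^e - 1)⌉}`, then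
`a z^{p^e}` lies in the `𝔞^t`-tight closure of zero in `F^e(M)`. -/
theorem smul_tmul_mem_zeroTightClosure {R : Type u} [CommRing R] {p : ℕ} [Fact p.Prime] [CharP R p]
    {𝔞 : Ideal R} {t : ℝ} {M : Type u} [AddCommGroup M] [Module R M] {z : M}
    (hz : z ∈ zeroTightClosure R p 𝔞 t M) {e : ℕ} {a : R}
    (ha : a ∈ 𝔞 ^ ⌈t * ((p : ℝ) ^ e - 1)⌉₊) :
    a • FrobModule.tmul R p e M 1 z ∈ zeroTightClosure R p 𝔞 t (FrobModule R p e M) := by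
  obtain ⟨c, hc, e₀, h⟩ := hz
  refine ⟨c, hc, e₀, fun e' he' b hb => ?_⟩
  -- The same `c` works: applying the second Frobenius turns `a` into `a ^ p ^ e'`, so level `e +
  -- e'` of the hypothesis on `z` applies.
  have h0 := congrArg (FrobModule.comparison R p e M e')
    (h (e + e') (by omega) _ (pow_mul_mem_pow_ceil 𝔞 t p e e' ha hb))
  rw [TensorProduct.smul_tmul', smul_eq_mul, mul_one, FrobModule.comparison_root_tmul,
    map_zero] at h0
  rw [TensorProduct.smul_tmul', smul_eq_mul, mul_one, ← TensorProduct.smul_tmul,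
    FrobRoot.smul_root, mul_left_comm]
  exact h0

/-- A map in `Hom_R(R^{1/p^e}, R) · J^{1/p^e}` sends everything to the annihilator of `z`
as soon as `J` kills `z^{p^e}` in `F^e(M)`. -/
theorem apply_smul_eq_zero_of_mem_homMulRoot {R : Type u} [CommRing R] {p e : ℕ} [Fact p.Prime]
    [CharP R p] {J : Ideal R} {M : Type u} [AddCommGroup M] [Module R M] {z : M}
    (hz : ∀ a ∈ J, a • FrobModule.tmul R p e M 1 z = 0)
    {φ : FrobRoot R p e →ₗ[R] R} (hφ : φ ∈ homMulRoot R p e J) (y : FrobRoot R p e) :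
    φ y • z = 0 := by
  induction hφ using Submodule.span_induction with
  | mem φ h =>
    obtain ⟨ψ, a, ha, rfl⟩ := h
    have h0 : FrobModule.tmul R p e M (FrobRoot.root R p e a * y) z = 0 := by
      obtain ⟨y, rfl⟩ := (FrobRoot.root R p e).surjective y
      rw [← map_mul, ← mul_one (FrobRoot.root R p e (a * y)), ← FrobModule.smul_tmul, mul_comm,
        mul_smul, hz a ha, smul_zero]
    -- Push the vanishing along `s ⊗ m ↦ ψ(s) m`.
    exact congrArg (TensorProduct.lift ((LinearMap.lsmul R M).comp ψ)) h0
  | zero => simp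
  | add φ φ' _ _ h h' => rw [LinearMap.add_apply, add_smul, h, h', add_zero]
  | smul r φ _ h => rw [LinearMap.smul_apply, smul_assoc, h, smul_zero]

theorem mem_testIdeal_of_pow_mem {R : Type u} [CommRing R] {p : ℕ} [Fact p.Prime] [CharP R p]
    {𝔞 : Ideal R} {t : ℝ} {e : ℕ} {φ : FrobRoot R p e →ₗ[R] R}
    (hφ : φ ∈ homMulRoot R p e (𝔞 ^ ⌈t * ((p : ℝ) ^ e - 1)⌉₊)) (hsurj : Function.Surjective φ)
    {r : R} (hr : r ^ p ^ e ∈ testIdeal R p 𝔞 t) : r ∈ testIdeal R p 𝔞 t := by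
  intro M _ _ _ z hz
  obtain ⟨y, hy⟩ := hsurj 1
  have h := apply_smul_eq_zero_of_mem_homMulRoot (z := r • z) (fun a ha => ?_) hφ y
  · rwa [hy, one_smul] at h
  · rw [FrobModule.one_tmul_smul, smul_comm]
    exact hr (FrobModule R p e M) _ (smul_tmul_mem_zeroTightClosure hz ha)

theorem mainTheorem10 (R : Type u) [CommRing R] [IsNoetherianRing R] [IsReduced R]
    (p : ℕ) [Fact p.Prime] [CharP R p] (hF : (frobenius R p).Finite)
    (𝔞 : Ideal R) (h𝔞 : ((𝔞 : Set R) ∩ ringCirc R).Nonempty) (t : ℝ) (ht : 0 < t)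
    (hpure : IsLocallySharplyFPure R p 𝔞 t) :
    (testIdeal R p 𝔞 t).IsRadical := by
  obtain ⟨e, he, φ, hφ, hsurj⟩ := hpure
  have key : ∀ (k : ℕ) (r : R), r ^ (p ^ e) ^ k ∈ testIdeal R p 𝔞 t → r ∈ testIdeal R p 𝔞 t := by
    intro k
    induction k with
    | zero => intro r hr; simpa using hr
    | succ k ih =>
      intro r hr
      rw [pow_succ, pow_mul] at hr
      exact ih r (mem_testIdeal_of_pow_mem hφ hsurj hr)
  rintro r ⟨n, hn⟩
  have hq : 1 < p ^ e := Nat.one_lt_pow he.ne' (Fact.out : p.Prime).one_lt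
  -- Since `n < (p ^ e) ^ n`, the exponent `n` can be raised to a power of `p ^ e`.
  exact key n r (Ideal.pow_mem_of_pow_mem _ hn (Nat.lt_pow_self hq).le)
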